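/- Let $n\ge 1$ and let $\mathbb H^n=\mathbb C^n\times\mathbb R$ be the Heisenberg group with group law $(\zeta,t)\cdot(\zeta',t')=(\zeta+\zeta',\,t+t'+2\,\mathrm{Im}\langle\zeta,\zeta'\rangle)$, where $\langle\zeta,\zeta'\rangle=\sum_{j=1}^n\zeta_j\overline{\zeta'_j}$. Let $\mathcal L^{2n+1}$ be the Lebesgue (outer) measure on $\mathbb H^n$, let $d_{CC}$ be the Carnot–Carathéodory metric defined by the left invariant fields $X_j=\partial_{\xi_j}+2\eta_j\partial_t$, $Y_j=\partial_{\eta_j}-2\xi_j\partial_t$ (where $\zeta_j=\xi_j+i\eta_j$, $j=1,\dots,n$), declared orthonormal, and let $B(x,r)$ be the open $d_{CC}$-ball with center $x$ and radius $r$. For $s\in(0,1)$ and nonempty $A,B\subseteq\mathbb H^n$ put $$Z_s(A,B)=\bigcup_{(x,y)\in A\times B}\{z\in\mathbb H^n:\ d_{CC}(x,z)=s\,d_{CC}(x,y),\ d_{CC}(z,y)=(1-s)\,d_{CC}(x,y)\}.$$ For $\chi\in\mathbb C^n$, $\theta\in[-2\pi,2\pi]$ let $$\Gamma_1(\chi,\theta)=\Big(i\,\frac{e^{-i\theta}-1}{\theta}\,\chi,\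 2|\chi|^2\,\frac{\theta-\sin\theta}{\theta^2}\Big)\ \text{ if }\theta\ne0,\qquad \Gamma_1(\chi,0)=(\chi,0).$$ For nonempty measurable sets $A,B\subseteq\mathbb H^n$ let $$\Theta_{A,B}=\sup_{A_0,B_0}\ \inf_{(x,y)\in A_0\times B_0}\big\{|\theta|:\ \theta\in[-2\pi,2\pi],\ \Gamma_1(\chi,\theta)=x^{-1}\cdot y\text{ for some }\chi\in\mathbb C^n\big\},$$ where $A_0\subseteq A$ and $B_0\subseteq B$ range over the nonempty full measure subsets of $A$ and $B$. Define $\tau_s^n:[0,2\pi]\to[0,\infty]$ by $\tau_s^n(2\pi)=+\infty$, $\tau_s^n(0)=s^{\frac{2n+3}{2n+1}}$ and, for $\theta\in(0,2\pi)$, $$\tau_s^n(\theta)=s^{\frac1{2n+1}}\Big(\frac{\sin\frac{\theta s}2}{\sin\frac\theta2}\Big)^{\frac{2n-1}{2n+1}}\Big(\frac{\sin\frac{\theta s}2-\frac{\theta s}2\cos\frac{\theta s}2}{\sin\frac\theta2-\frac\theta2\cos\frac\theta2}\Big)^{\frac1{2n+1}}.$$ **Proposition 4.2.** Let $s\in(0,1)$,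 $A_r=B((0_{\mathbb C^n},0),r)$ and $B_r=B((0_{\mathbb C^n},1),r)$. Then: (i) there are $c,\delta>0$ with $\mathcal L^{2n+1}(Z_s(A_r,B_r))\ge c\,r^3$ for every $r\in(0,\delta)$; (ii) $2\pi-\Theta_{A_r,B_r}=\mathcal O(r)$ as $r\to0$, i.e. there are $C,\delta>0$ with $|2\pi-\Theta_{A_r,B_r}|\le C\,r$ for every $r\in(0,\delta)$; (iii) there are $c,\delta>0$ with $\tau_s^n(\Theta_{A_r,B_r})\ge c\,r^{\frac{1-2n}{1+2n}}$ for every $r\in(0,\delta)$. The constants may depend on $n$ and $s$. -/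

import Mathlib

open scoped ENNReal

noncomputable section

/-- The underlying space `ℂⁿ × ℝ` of the Heisenberg group `ℍⁿ`; a point is `(ζ, t)`.  Its `volume`
is the product Lebesgue measure `𝓛²ⁿ⁺¹`.  The instances on the type are the additive and topological
ones of the vector space `ℂⁿ × ℝ`; the group law of `ℍⁿ` is `Heisenberg.mul` below. -/
abbrev Heisenberg (n : ℕ) : Type := (Fin n → ℂ) × ℝ

namespace Heisenberg

variable {n : ℕ}

/-- The Hermitian product `⟨ζ, ζ'⟩ = ∑ ζ_j * conj ζ'_j` on `ℂⁿ`. -/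
def herm (z w : Fin n → ℂ) : ℂ := ∑ j, z j * (starRingEnd ℂ) (w j)

/-- The square `|χ|²` of the Hermitian (Euclidean) norm on `ℂⁿ`. -/
def normSq (z : Fin n → ℂ) : ℝ := ∑ j, ‖z j‖ ^ 2

/-- The group law `(ζ, t) · (ζ', t') = (ζ + ζ', t + t' + 2 Im ⟨ζ, ζ'⟩)`. -/
def mul (x y : Heisenberg n) : Heisenberg n :=
  (x.1 + y.1, x.2 + y.2 + 2 * (herm x.1 y.1).im)

/-- The group inverse `(ζ, t)⁻¹ = (-ζ, -t)`. -/
def inv (x : Heisenberg n) : Heisenberg n := (-x.1, -x.2)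

/-- The left invariant field `X_j = ∂_{ξ_j} + 2 η_j ∂_t`, where `ζ_j = ξ_j + i η_j`. -/
def fieldX (j : Fin n) (x : Heisenberg n) : Heisenberg n :=
  (Pi.single j 1, 2 * (x.1 j).im)

/-- The left invariant field `Y_j = ∂_{η_j} - 2 ξ_j ∂_t`, where `ζ_j = ξ_j + i η_j`. -/
def fieldY (j : Fin n) (x : Heisenberg n) : Heisenberg n :=
  (Pi.single j Complex.I, -(2 * (x.1 j).re))

/-- `γ : [0, T] → ℍⁿ` is a horizontal curve, whose velocity has the measurable coordinates
`h j` and `k j` in the fields `X_j` and `Y_j`. -/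
structure IsHorizontal (T : ℝ) (γ : ℝ → Heisenberg n) (h k : Fin n → ℝ → ℝ) : Prop where
  nonneg : 0 ≤ T
  absCont : AbsolutelyContinuousOnInterval γ 0 T
  measurable_h : ∀ j, Measurable (h j)
  measurable_k : ∀ j, Measurable (k j)
  deriv : ∀ᵐ s ∂(MeasureTheory.volume.restrict (Set.Icc 0 T)),
    HasDerivAt γ (∑ j, (h j s • fieldX j (γ s) + k j s • fieldY j (γ s))) s

/-- The length `∫₀ᵀ √(∑ (h_j² + k_j²)) ds` of a horizontal curve with velocity coordinates
`h`, `k`. -/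
def length (T : ℝ) (h k : Fin n → ℝ → ℝ) : ℝ≥0∞ :=
  ∫⁻ s in Set.Icc 0 T, ENNReal.ofReal (Real.sqrt (∑ j, (h j s ^ 2 + k j s ^ 2)))

/-- The Carnot–Carathéodory distance: the infimum of the lengths of the horizontal curves from `x`
to `y`.  It is recorded as an extended nonnegative number, so that an infimum over no curve at all
would be `∞`. -/
def dCC (x y : Heisenberg n) : ℝ≥0∞ :=
  sInf {ℓ | ∃ (T : ℝ) (γ : ℝ → Heisenberg n) (h k : Fin n → ℝ → ℝ),
    IsHorizontal T γ h k ∧ γ 0 = x ∧ γ T = y ∧ ℓ = length T h k}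

/-- The open Carnot–Carathéodory ball `B(y, r)`. -/
def ball (y : Heisenberg n) (r : ℝ) : Set (Heisenberg n) :=
  {w | dCC y w < ENNReal.ofReal r}

/-- The set `Z_s(x, y)` of `s`-intermediate points of two points, for `s ∈ [0, 1]`. -/
def interPt (s : ℝ) (x y : Heisenberg n) : Set (Heisenberg n) :=
  {z | dCC x z = ENNReal.ofReal s * dCC x y ∧ dCC z y = ENNReal.ofReal (1 - s) * dCC x y}

/-- The set `Z_s(A, B)` of `s`-intermediate points of two sets. -/
def inter (s : ℝ) (A B : Set (Heisenberg n)) : Set (Heisenberg n) :=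
  ⋃ x ∈ A, ⋃ y ∈ B, interPt s x y

/-- The curve `γ_{χ,θ}`. -/
def geod (χ : Fin n → ℂ) (θ s : ℝ) : Heisenberg n :=
  if θ = 0 then ((s : ℂ) • χ, 0)
  else ((Complex.I * ((Complex.exp (-(Complex.I * θ * s)) - 1) / θ)) • χ,
    2 * normSq χ * ((θ * s - Real.sin (θ * s)) / θ ^ 2))

/-- The endpoint map `Γ₁(χ, θ) = γ_{χ,θ}(1)`. -/
def endpt (χ : Fin n → ℂ) (θ : ℝ) : Heisenberg n := geod χ θ 1

/-- The angles `|θ|`, with `θ ∈ [-2π, 2π]` and `Γ₁(χ, θ) = x⁻¹ · y` for some `χ`, that occur for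
pairs `(x, y) ∈ A × B`. -/
def angles (A B : Set (Heisenberg n)) : Set ℝ :=
  {a | ∃ x ∈ A, ∃ y ∈ B, ∃ (χ : Fin n → ℂ) (θ : ℝ),
    θ ∈ Set.Icc (-(2 * Real.pi)) (2 * Real.pi) ∧ endpt χ θ = mul (inv x) y ∧ a = |θ|}

/-- The quantity `Θ_{A,B}`: the supremum, over nonempty full measure subsets `A₀ ⊆ A`, `B₀ ⊆ B`, of
the infimum of the angles of the pairs in `A₀ × B₀`. -/
def Theta (A B : Set (Heisenberg n)) : ℝ :=
  sSup {m | ∃ A₀ B₀ : Set (Heisenberg n), A₀ ⊆ A ∧ B₀ ⊆ B ∧ A₀.Nonempty ∧ B₀.Nonempty ∧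
    MeasureTheory.volume (A \ A₀) = 0 ∧ MeasureTheory.volume (B \ B₀) = 0 ∧
    m = sInf (angles A₀ B₀)}

/-- The Heisenberg distortion coefficient `τ_s^n(θ) ∈ [0, ∞]`, for `θ ∈ [0, 2π]`. -/
def tau (n : ℕ) (s θ : ℝ) : ℝ≥0∞ :=
  if θ = 2 * Real.pi then ∞
  else if θ = 0 then ENNReal.ofReal (s ^ ((2 * n + 3 : ℝ) / (2 * n + 1)))
  else ENNReal.ofReal (s ^ ((1 : ℝ) / (2 * n + 1)) *
    (Real.sin (θ * s / 2) / Real.sin (θ / 2)) ^ ((2 * n - 1 : ℝ) / (2 * n + 1)) *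
    ((Real.sin (θ * s / 2) - θ * s / 2 * Real.cos (θ * s / 2)) /
      (Real.sin (θ / 2) - θ / 2 * Real.cos (θ / 2))) ^ ((1 : ℝ) / (2 * n + 1)))

end Heisenberg

end

noncomputable section

open MeasureTheory
open scoped Pointwise

/-! The points 0 and (0,1) are joined by the whole family of geodesics of angle 2π with |χ|² = π. At
time s these fill a sphere |ζ| = R, t = t₀ of codimension two (`exists_geod_eq`). Since (0,1) is
central, left translation by (ζ,0) with |ζ| < r moves both endpoints inside their balls, and it
carries intermediate points to intermediate points. These translates cover a neighbourhood of the
sphere of width comparable to r in both normal directions (`mem_inter_ball`), so the volume is at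
least of order r², which for r < 1 exceeds the required r³.

Minimality of these geodesics rests on `calibration`: with ℓ the arclength, επt + π cot(α + √π
ℓ)|ζ|² − √π ℓ does not increase along a horizontal curve. Suitable phases α bound from below the
distance from each end to the point at time s. The phase that makes the cotangent vanish at the
final point bounds the vertical extent of small balls.

For (ii), if x and y lie in the two balls, x⁻¹y has horizontal part O(r) and height at least 1/2.
Comparing these through Γ₁ gives 1 − cos θ ≤ 8r²(θ − sin θ), which forces θ to be within O(r) of 2π.
In (iii) the factor sin(θ/2) = O(r) in the denominator produces the blow-up, the other factors being
controlled. -/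

/-! ### Absolutely continuous functions. -/

/-- An absolutely continuous function with a.e. nonpositive derivative does not increase. -/
theorem AbsolutelyContinuousOnInterval.le_of_ae_hasDerivAt_nonpos {G g : ℝ → ℝ} {T : ℝ}
    (hT : 0 ≤ T) (hG : AbsolutelyContinuousOnInterval G 0 T)
    (hd : ∀ᵐ u ∂(volume.restrict (Set.Icc 0 T)), HasDerivAt G (g u) u)
    (hg : ∀ u ∈ Set.Icc 0 T, g u ≤ 0) : G T ≤ G 0 := by
  have h1 := hG.integral_deriv_eq_sub
  have h2 : ∫ u in (0 : ℝ)..T, deriv G u ≤ 0 := by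
    rw [intervalIntegral.integral_of_le hT]
    refine integral_nonpos_of_ae ?_
    have h3 : ∀ᵐ u ∂(volume.restrict (Set.Ioc 0 T)), HasDerivAt G (g u) u :=
      ae_restrict_of_ae_restrict_of_subset Set.Ioc_subset_Icc_self hd
    filter_upwards [h3, ae_restrict_mem measurableSet_Ioc] with u hu hm
    rw [hu.deriv]
    exact hg u (Set.Ioc_subset_Icc_self hm)
  linarith

theorem LipschitzOnWith.comp_absolutelyContinuousOnInterval {X Y : Type*} [PseudoMetricSpace X]
    [PseudoMetricSpace Y] {f : X → Y} {K : NNReal} {S : Set X} (hf : LipschitzOnWith K f S)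
    {γ : ℝ → X} {a b : ℝ} (hγ : AbsolutelyContinuousOnInterval γ a b)
    (hS : Set.MapsTo γ (Set.uIcc a b) S) :
    AbsolutelyContinuousOnInterval (fun u => f (γ u)) a b := by
  rw [absolutelyContinuousOnInterval_iff] at hγ ⊢
  intro ε hε
  obtain ⟨δ, hδ, H⟩ := hγ (ε / (K + 1)) (by positivity)
  refine ⟨δ, hδ, fun E hE hl => ?_⟩
  have h1 := H E hE hl
  calc _ ≤ ∑ i ∈ Finset.range E.1, K * dist (γ (E.2 i).1) (γ (E.2 i).2) := by
        refine Finset.sum_le_sum fun i hi => ?_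
        exact hf.dist_le_mul _ (hS (hE.1 i hi).1) _ (hS (hE.1 i hi).2)
    _ = K * ∑ i ∈ Finset.range E.1, dist (γ (E.2 i).1) (γ (E.2 i).2) := by
        rw [Finset.mul_sum]
    _ ≤ (K + 1) * ∑ i ∈ Finset.range E.1, dist (γ (E.2 i).1) (γ (E.2 i).2) := by
        gcongr
        linarith
    _ < (K + 1) * (ε / (K + 1)) := by gcongr
    _ = ε := by field_simp

theorem AbsolutelyContinuousOnInterval.sum {ι : Type*} (s : Finset ι) {f : ι → ℝ → ℝ} {a b : ℝ}
    (hf : ∀ i ∈ s, AbsolutelyContinuousOnInterval (f i) a b) :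
    AbsolutelyContinuousOnInterval (fun u => ∑ i ∈ s, f i u) a b := by
  classical
  induction s using Finset.induction_on with
  | empty =>
    simpa using (LipschitzWith.const (0 : ℝ)).lipschitzOnWith.absolutelyContinuousOnInterval
  | insert i s hi ih =>
    simp only [Finset.sum_insert hi]
    exact (hf i (Finset.mem_insert_self i s)).fun_add
      (ih fun j hj => hf j (Finset.mem_insert_of_mem hj))

namespace Heisenberg

variable {n : ℕ}

/-! ### Real coordinates and speed. -/

theorem normSq_eq (z : Fin n → ℂ) : normSq z = ∑ j, ((z j).re ^ 2 + (z j).im ^ 2) := by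
  simp only [normSq, Complex.sq_norm, Complex.normSq_apply, ← sq]

theorem normSq_nonneg (z : Fin n → ℂ) : 0 ≤ normSq z :=
  Finset.sum_nonneg fun _ _ => sq_nonneg _

theorem herm_im (z w : Fin n → ℂ) :
    (herm z w).im = ∑ j, ((z j).im * (w j).re - (z j).re * (w j).im) := by
  simp only [herm, Complex.im_sum, Complex.mul_im, Complex.conj_re, Complex.conj_im]
  exact Finset.sum_congr rfl fun j _ => by ring

/-- The speed of a curve with velocity coordinates `h`, `k`. -/
def speed (h k : Fin n → ℝ → ℝ) (u : ℝ) : ℝ := Real.sqrt (∑ j, (h j u ^ 2 + k j u ^ 2))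

theorem speed_nonneg (h k : Fin n → ℝ → ℝ) (u : ℝ) : 0 ≤ speed h k u := Real.sqrt_nonneg _

theorem speed_sq (h k : Fin n → ℝ → ℝ) (u : ℝ) :
    speed h k u ^ 2 = ∑ j, (h j u ^ 2 + k j u ^ 2) :=
  Real.sq_sqrt (Finset.sum_nonneg fun _ _ => by positivity)

/-- Cauchy–Schwarz in ℝ²ⁿ, with coordinates indexed by `Fin n ⊕ Fin n`. -/
theorem sum_mul_le_speed_mul (h k : Fin n → ℝ → ℝ) (u : ℝ) (a b : Fin n → ℝ) {c : ℝ}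
    (hc : 0 ≤ c) (hab : ∑ j, (a j ^ 2 + b j ^ 2) ≤ c ^ 2) :
    ∑ j, (a j * h j u + b j * k j u) ≤ c * speed h k u := by
  have h1 := Finset.sum_mul_sq_le_sq_mul_sq (Finset.univ : Finset (Fin n ⊕ Fin n))
    (Sum.elim a b) (Sum.elim (fun j => h j u) (fun j => k j u))
  simp only [Fintype.sum_sum_type, Sum.elim_inl, Sum.elim_inr, ← Finset.sum_add_distrib] at h1
  refine abs_le_of_sq_le_sq' ?_ (mul_nonneg hc (speed_nonneg _ _ _)) |>.2
  rw [mul_pow, speed_sq]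
  refine h1.trans ?_
  gcongr

/-! ### Arclength and coordinates along horizontal curves. -/

section Curve

variable {T : ℝ} {γ : ℝ → Heisenberg n} {h k : Fin n → ℝ → ℝ}

namespace IsHorizontal

theorem measurable_speed (H : IsHorizontal T γ h k) : Measurable (speed h k) := by
  unfold speed
  have h1 := H.measurable_h
  have h2 := H.measurable_k
  fun_prop

theorem integrableOn_speed (H : IsHorizontal T γ h k) (hL : length T h k ≠ ∞) :
    IntegrableOn (speed h k) (Set.Icc 0 T) := by
  refine ⟨H.measurable_speed.aestronglyMeasurable, ?_⟩
  rw [hasFiniteIntegral_iff_ofReal (Filter.Eventually.of_forall fun u => speed_nonneg h k u)]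
  exact lt_top_iff_ne_top.2 hL

theorem intervalIntegrable_speed (H : IsHorizontal T γ h k) (hL : length T h k ≠ ∞) :
    IntervalIntegrable (speed h k) volume 0 T := by
  rw [intervalIntegrable_iff_integrableOn_Icc_of_le H.nonneg]
  exact H.integrableOn_speed hL

theorem integral_speed (H : IsHorizontal T γ h k) :
    ∫ u in (0 : ℝ)..T, speed h k u = (length T h k).toReal := by
  rw [intervalIntegral.integral_of_le H.nonneg, ← integral_Icc_eq_integral_Ioc,
    integral_eq_lintegral_of_nonneg_ae
      (Filter.Eventually.of_forall fun u => speed_nonneg h k u)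
      H.measurable_speed.aestronglyMeasurable]
  rfl

theorem hasDerivAt_arclength (H : IsHorizontal T γ h k) (hL : length T h k ≠ ∞) :
    ∀ᵐ u ∂(volume.restrict (Set.Icc 0 T)),
      HasDerivAt (fun x => ∫ v in (0 : ℝ)..x, speed h k v) (speed h k u) u := by
  rw [ae_restrict_iff' measurableSet_Icc]
  filter_upwards [(H.intervalIntegrable_speed hL).ae_hasDerivAt_integral] with u hu hm
  exact hu (by rwa [Set.uIcc_of_le H.nonneg]) 0 Set.left_mem_uIcc

theorem arclength_mem (H : IsHorizontal T γ h k) (hL : length T h k ≠ ∞) {u : ℝ}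
    (hu : u ∈ Set.Icc 0 T) :
    ∫ v in (0 : ℝ)..u, speed h k v ∈ Set.Icc 0 (length T h k).toReal := by
  refine ⟨intervalIntegral.integral_nonneg hu.1 fun v _ => speed_nonneg h k v, ?_⟩
  rw [← H.integral_speed]
  exact intervalIntegral.integral_mono_interval le_rfl hu.1 hu.2
    (Filter.Eventually.of_forall fun u => speed_nonneg h k u) (H.intervalIntegrable_speed hL)

theorem absCont_re (H : IsHorizontal T γ h k) (j : Fin n) :
    AbsolutelyContinuousOnInterval (fun u => ((γ u).1 j).re) 0 T :=
  ((Complex.reCLM.comp ((ContinuousLinearMap.proj (R := ℝ) j).comp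
    (ContinuousLinearMap.fst ℝ (Fin n → ℂ) ℝ))).lipschitz.lipschitzOnWith
      (s := Set.univ)).comp_absolutelyContinuousOnInterval H.absCont (Set.mapsTo_univ _ _)

theorem absCont_im (H : IsHorizontal T γ h k) (j : Fin n) :
    AbsolutelyContinuousOnInterval (fun u => ((γ u).1 j).im) 0 T :=
  ((Complex.imCLM.comp ((ContinuousLinearMap.proj (R := ℝ) j).comp
    (ContinuousLinearMap.fst ℝ (Fin n → ℂ) ℝ))).lipschitz.lipschitzOnWith
      (s := Set.univ)).comp_absolutelyContinuousOnInterval H.absCont (Set.mapsTo_univ _ _)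

theorem absCont_snd (H : IsHorizontal T γ h k) :
    AbsolutelyContinuousOnInterval (fun u => (γ u).2) 0 T :=
  ((ContinuousLinearMap.snd ℝ (Fin n → ℂ) ℝ).lipschitz.lipschitzOnWith
      (s := Set.univ)).comp_absolutelyContinuousOnInterval H.absCont (Set.mapsTo_univ _ _)

end IsHorizontal

/-- The coordinate form of a horizontal velocity. -/
theorem sum_fields (h k : Fin n → ℝ) (x : Heisenberg n) :
    ∑ j, (h j • fieldX j x + k j • fieldY j x) =
      (fun j => (⟨h j, k j⟩ : ℂ), ∑ j, 2 * ((x.1 j).im * h j - (x.1 j).re * k j)) := by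
  refine Prod.ext ?_ ?_
  · funext i
    simp only [Prod.fst_sum, Finset.sum_apply, fieldX, fieldY, Prod.fst_add, Prod.smul_fst,
      Pi.add_apply, Pi.smul_apply, Pi.single_apply]
    rw [Finset.sum_eq_single i]
    · apply Complex.ext <;> simp
    · intro j _ hj
      simp [hj.symm]
    · simp
  · simp only [Prod.snd_sum, fieldX, fieldY, Prod.snd_add, Prod.smul_snd, smul_eq_mul]
    exact Finset.sum_congr rfl fun j _ => by ring

namespace IsHorizontal

theorem hasDerivAt_coords (H : IsHorizontal T γ h k) :
    ∀ᵐ u ∂(volume.restrict (Set.Icc 0 T)),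
      (∀ j, HasDerivAt (fun u => ((γ u).1 j).re) (h j u) u) ∧
      (∀ j, HasDerivAt (fun u => ((γ u).1 j).im) (k j u) u) ∧
      HasDerivAt (fun u => (γ u).2)
        (∑ j, 2 * (((γ u).1 j).im * h j u - ((γ u).1 j).re * k j u)) u := by
  filter_upwards [H.deriv] with u hu
  rw [sum_fields (fun j => h j u) (fun j => k j u)] at hu
  have h1 : ∀ j, HasDerivAt (fun u => (γ u).1 j) (⟨h j u, k j u⟩ : ℂ) u :=
    fun j => (hasDerivAt_pi.1 hu.fst) j
  refine ⟨fun j => ?_, fun j => ?_, hu.snd⟩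
  · exact Complex.reCLM.hasFDerivAt.comp_hasDerivAt u (h1 j)
  · exact Complex.imCLM.hasFDerivAt.comp_hasDerivAt u (h1 j)

theorem absCont_normSq (H : IsHorizontal T γ h k) :
    AbsolutelyContinuousOnInterval (fun u => normSq (γ u).1) 0 T := by
  simp only [normSq_eq, sq]
  exact AbsolutelyContinuousOnInterval.sum _ fun j _ =>
    ((H.absCont_re j).fun_mul (H.absCont_re j)).fun_add
      ((H.absCont_im j).fun_mul (H.absCont_im j))

/-! ### Calibration and horizontal projection. -/

/-- The calibration inequality with the Riccati solution `π cot`, which rules the lengths of the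
geodesics of full angle `2π`. -/
theorem calibration (H : IsHorizontal T γ h k) (hL : length T h k ≠ ∞) {ε α : ℝ}
    (hε : ε ^ 2 = 1) (hα : 0 < α) (hαL : α + √Real.pi * (length T h k).toReal < Real.pi) :
    ε * Real.pi * (γ T).2 + Real.pi * Real.cot (α + √Real.pi * (length T h k).toReal) *
        normSq (γ T).1 - √Real.pi * (length T h k).toReal ≤
      ε * Real.pi * (γ 0).2 + Real.pi * Real.cot α * normSq (γ 0).1 := by
  set L := (length T h k).toReal with hLdef
  set ℓ : ℝ → ℝ := fun x => ∫ v in (0 : ℝ)..x, speed h k v with hℓ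
  have hπ := Real.pi_pos
  have hsπ : 0 < √Real.pi := Real.sqrt_pos.2 hπ
  have hss : √Real.pi * √Real.pi = Real.pi := Real.mul_self_sqrt hπ.le
  have hℓmem : ∀ u ∈ Set.Icc 0 T, ℓ u ∈ Set.Icc 0 L := fun u hu => H.arclength_mem hL hu
  have hℓac : AbsolutelyContinuousOnInterval ℓ 0 T :=
    (H.intervalIntegrable_speed hL).absolutelyContinuousOnInterval_intervalIntegral
      Set.left_mem_uIcc
  have hsin : ∀ l ∈ Set.Icc 0 L, 0 < Real.sin (α + √Real.pi * l) := fun l hl => by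
    have : √Real.pi * l ≤ √Real.pi * L := by gcongr; exact hl.2
    have : 0 ≤ √Real.pi * l := mul_nonneg hsπ.le hl.1
    exact Real.sin_pos_of_pos_of_lt_pi (by linarith) (by linarith)
  -- The phase stays in a compact subinterval of (0, π), where the cotangent is Lipschitz; hence its
  -- composition with arclength is absolutely continuous.
  obtain ⟨K, hK⟩ : ∃ K, LipschitzOnWith K (fun l => Real.cot (α + √Real.pi * l))
      (Set.Icc 0 L) := by
    have : ContDiffOn ℝ 1 (fun l => Real.cot (α + √Real.pi * l)) (Set.Icc 0 L) := by
      simp only [Real.cot_eq_cos_div_sin]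
      refine ContDiffOn.div ?_ ?_ fun l hl => (hsin l hl).ne'
      · exact (Real.contDiff_cos.comp (by fun_prop)).contDiffOn
      · exact (Real.contDiff_sin.comp (by fun_prop)).contDiffOn
    exact this.exists_lipschitzOnWith (by decide) (convex_Icc _ _) isCompact_Icc
  have hcot : AbsolutelyContinuousOnInterval (fun u => Real.cot (α + √Real.pi * ℓ u)) 0 T :=
    hK.comp_absolutelyContinuousOnInterval hℓac fun u hu =>
      hℓmem u (by rwa [Set.uIcc_of_le H.nonneg] at hu)
  have key := AbsolutelyContinuousOnInterval.le_of_ae_hasDerivAt_nonpos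
    (G := fun u => ε * Real.pi * (γ u).2 +
      Real.pi * (Real.cot (α + √Real.pi * ℓ u) * normSq (γ u).1) - √Real.pi * ℓ u)
    (g := fun u => ε * Real.pi * (∑ j, 2 * (((γ u).1 j).im * h j u - ((γ u).1 j).re * k j u)) +
      Real.pi * (-(√Real.pi * speed h k u) / Real.sin (α + √Real.pi * ℓ u) ^ 2 * normSq (γ u).1 +
        Real.cot (α + √Real.pi * ℓ u) *
          ∑ j, 2 * (((γ u).1 j).re * h j u + ((γ u).1 j).im * k j u)) -
      √Real.pi * speed h k u) H.nonneg ?_ ?_ ?_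
  · have h0 : ℓ 0 = 0 := by simp [hℓ]
    have hT : ℓ T = L := H.integral_speed
    simp only [h0, hT, mul_zero, add_zero, sub_zero] at key
    linarith
  · exact ((H.absCont_snd.const_mul _).fun_add
      ((hcot.fun_mul H.absCont_normSq).const_mul _)).fun_sub (hℓac.const_mul _)
  · filter_upwards [H.hasDerivAt_coords, H.hasDerivAt_arclength hL,
      ae_restrict_mem measurableSet_Icc] with u hu hu' hm
    obtain ⟨h1, h2, h3⟩ := hu
    have hs := hsin _ (hℓmem u hm)
    have hN : HasDerivAt (fun u => normSq (γ u).1)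
        (∑ j, 2 * (((γ u).1 j).re * h j u + ((γ u).1 j).im * k j u)) u := by
      simp only [normSq_eq]
      refine (HasDerivAt.fun_sum fun j _ =>
        ((h1 j).fun_pow 2).fun_add ((h2 j).fun_pow 2)).congr_deriv ?_
      refine Finset.sum_congr rfl fun j _ => ?_
      push_cast
      ring
    have hφ : HasDerivAt (fun u => α + √Real.pi * ℓ u) (√Real.pi * speed h k u) u :=
      (hu'.const_mul _).const_add _
    have hc : HasDerivAt (fun u => Real.cot (α + √Real.pi * ℓ u))
        (-(√Real.pi * speed h k u) / Real.sin (α + √Real.pi * ℓ u) ^ 2) u := by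
      simp only [Real.cot_eq_cos_div_sin]
      refine (hφ.cos.fun_div hφ.sin hs.ne').congr_deriv ?_
      congr 1
      linear_combination (-(√Real.pi * speed h k u)) *
        Real.sin_sq_add_cos_sq (α + √Real.pi * ℓ u)
    exact ((h3.const_mul _).fun_add ((hc.fun_mul hN).const_mul _)).fun_sub (hu'.const_mul _)
  · intro u hm
    have hs := hsin _ (hℓmem u hm)
    have hsc := Real.sin_sq_add_cos_sq (α + √Real.pi * ℓ u)
    simp only [Real.cot_eq_cos_div_sin]
    set S := Real.sin (α + √Real.pi * ℓ u)
    set C := Real.cos (α + √Real.pi * ℓ u)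
    set N := normSq (γ u).1 with hNdef
    have hN0 : 0 ≤ N := normSq_nonneg _
    -- The vector paired with the velocity is the sum of a quarter turn of ζ and of cot · ζ. These
    -- are orthogonal, so its length is |ζ|√(1 + cot²) = |ζ|/sin.
    have hcs := sum_mul_le_speed_mul h k u
      (fun j => ε * ((γ u).1 j).im + C / S * ((γ u).1 j).re)
      (fun j => -ε * ((γ u).1 j).re + C / S * ((γ u).1 j).im)
      (c := √N / S) (by positivity) (by
        rw [div_pow, Real.sq_sqrt hN0, hNdef, normSq_eq, Finset.sum_div]
        refine le_of_eq (Finset.sum_congr rfl fun j _ => ?_)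
        field_simp
        linear_combination (((γ u).1 j).re ^ 2 + ((γ u).1 j).im ^ 2) * (S ^ 2 * hε + hsc))
    have hv := speed_nonneg h k u
    set v := speed h k u
    -- The square (1 − √π |ζ|/sin)² ≥ 0: the derivative of the cotangent and the term −√π ℓ together
    -- absorb the Cauchy–Schwarz bound.
    have hsq : 2 * Real.pi * (√N / S * v) ≤ √Real.pi * v * (1 + Real.pi * N / S ^ 2) := by
      have h4 := mul_nonneg (mul_nonneg hsπ.le hv) (sq_nonneg (1 - √Real.pi * (√N / S)))
      have h5 : √Real.pi * v * (1 - √Real.pi * (√N / S)) ^ 2 =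
          √Real.pi * v * (1 + (√Real.pi * √Real.pi) * (√N ^ 2 / S ^ 2)) -
            2 * (√Real.pi * √Real.pi) * (√N / S * v) := by ring
      rw [h5, hss, Real.sq_sqrt hN0] at h4
      rw [mul_div_assoc]
      linarith
    have hsum : ∑ j, ((ε * ((γ u).1 j).im + C / S * ((γ u).1 j).re) * h j u +
        (-ε * ((γ u).1 j).re + C / S * ((γ u).1 j).im) * k j u) =
        (ε * (∑ j, 2 * (((γ u).1 j).im * h j u - ((γ u).1 j).re * k j u)) +
          C / S * ∑ j, 2 * (((γ u).1 j).re * h j u + ((γ u).1 j).im * k j u)) / 2 := by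
      rw [Finset.mul_sum, Finset.mul_sum, ← Finset.sum_add_distrib, Finset.sum_div]
      exact Finset.sum_congr rfl fun j _ => by ring
    rw [hsum] at hcs
    have h6 : √Real.pi * v * (1 + Real.pi * N / S ^ 2) =
      √Real.pi * v - Real.pi * (-(√Real.pi * v) / S ^ 2 * N) := by ring
    rw [h6] at hsq
    have h7 := mul_le_mul_of_nonneg_left hcs (by positivity : 0 ≤ 2 * Real.pi)
    linarith

/-- Along the curve, the pairing of the horizontal part with the fixed displacement w, minus |w|ℓ,
does not increase. Hence |w|² ≤ |w|L. -/
theorem normSq_sub_le (H : IsHorizontal T γ h k) (hL : length T h k ≠ ∞) :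
    normSq ((γ T).1 - (γ 0).1) ≤ (length T h k).toReal ^ 2 := by
  set L := (length T h k).toReal with hLdef
  set ℓ : ℝ → ℝ := fun x => ∫ v in (0 : ℝ)..x, speed h k v with hℓ
  set w := (γ T).1 - (γ 0).1 with hw
  have hℓac : AbsolutelyContinuousOnInterval ℓ 0 T :=
    (H.intervalIntegrable_speed hL).absolutelyContinuousOnInterval_intervalIntegral
      Set.left_mem_uIcc
  have key := AbsolutelyContinuousOnInterval.le_of_ae_hasDerivAt_nonpos
    (G := fun u => ∑ j, ((w j).re * ((γ u).1 j).re + (w j).im * ((γ u).1 j).im) -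
      √(normSq w) * ℓ u)
    (g := fun u => ∑ j, ((w j).re * h j u + (w j).im * k j u) - √(normSq w) * speed h k u)
    H.nonneg ?_ ?_ ?_
  · have h0 : ℓ 0 = 0 := by simp [hℓ]
    have hT : ℓ T = L := H.integral_speed
    simp only [h0, hT, mul_zero, sub_zero] at key
    have h1 : normSq w ≤ √(normSq w) * L := by
      have : normSq w = ∑ j, ((w j).re * ((γ T).1 j).re + (w j).im * ((γ T).1 j).im) -
          ∑ j, ((w j).re * ((γ 0).1 j).re + (w j).im * ((γ 0).1 j).im) := by
        rw [normSq_eq, ← Finset.sum_sub_distrib]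
        refine Finset.sum_congr rfl fun j _ => ?_
        simp only [hw, Pi.sub_apply, Complex.sub_re, Complex.sub_im]
        ring
      linarith
    have h2 := Real.sq_sqrt (normSq_nonneg w)
    have h3 := Real.sqrt_nonneg (normSq w)
    nlinarith [sq_nonneg (√(normSq w) - L)]
  · exact (AbsolutelyContinuousOnInterval.sum _ fun j _ =>
      ((H.absCont_re j).const_mul _).fun_add ((H.absCont_im j).const_mul _)).fun_sub
        (hℓac.const_mul _)
  · filter_upwards [H.hasDerivAt_coords, H.hasDerivAt_arclength hL] with u hu hu'
    obtain ⟨h1, h2, -⟩ := hu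
    exact (HasDerivAt.fun_sum fun j _ => ((h1 j).const_mul _).fun_add
      ((h2 j).const_mul _)).fun_sub (hu'.const_mul _)
  · intro u _
    have := sum_mul_le_speed_mul h k u (fun j => (w j).re) (fun j => (w j).im)
      (Real.sqrt_nonneg (normSq w)) (by rw [Real.sq_sqrt (normSq_nonneg w), normSq_eq])
    linarith

end IsHorizontal

end Curve

/-! ### Left translations and invariance of the distance. -/

/-- The linear functional `z ↦ Im ⟨g, z⟩`. -/
def hermImCLM (g : Fin n → ℂ) : (Fin n → ℂ) →L[ℝ] ℝ :=
  ∑ j, ((g j).im • Complex.reCLM.comp (ContinuousLinearMap.proj (R := ℝ) j) -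
    (g j).re • Complex.imCLM.comp (ContinuousLinearMap.proj (R := ℝ) j))

theorem hermImCLM_apply (g z : Fin n → ℂ) : hermImCLM g z = (herm g z).im := by
  rw [herm_im]
  simp [hermImCLM]

/-- Left translation is affine, so absolute continuity and derivatives pass through it. -/
theorem mul_eq_add (g x : Heisenberg n) :
    mul g x = g + ((ContinuousLinearMap.fst ℝ (Fin n → ℂ) ℝ).prod
      (ContinuousLinearMap.snd ℝ (Fin n → ℂ) ℝ +
        (2 : ℝ) • (hermImCLM g.1).comp (ContinuousLinearMap.fst ℝ (Fin n → ℂ) ℝ))) x := by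
  refine Prod.ext rfl ?_
  simp [mul, hermImCLM_apply, add_assoc]

theorem inv_mul_mul (g x : Heisenberg n) : mul (inv g) (mul g x) = x := by
  refine Prod.ext ?_ ?_
  · simp [mul, inv]
  · simp only [mul, inv, herm_im, Pi.add_apply, Pi.neg_apply, Complex.add_re, Complex.add_im,
      Complex.neg_re, Complex.neg_im]
    have : ∑ j, (-(g.1 j).im * ((g.1 j).re + (x.1 j).re) -
        -(g.1 j).re * ((g.1 j).im + (x.1 j).im)) =
        -∑ j, ((g.1 j).im * (x.1 j).re - (g.1 j).re * (x.1 j).im) := by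
      rw [← Finset.sum_neg_distrib]
      exact Finset.sum_congr rfl fun j _ => by ring
    rw [this]
    ring

/-- Left translates of horizontal curves are horizontal, with the same velocity coordinates. -/
theorem IsHorizontal.mul_left {T : ℝ} {γ : ℝ → Heisenberg n} {h k : Fin n → ℝ → ℝ}
    (H : IsHorizontal T γ h k) (g : Heisenberg n) :
    IsHorizontal T (fun u => mul g (γ u)) h k where
  nonneg := H.nonneg
  measurable_h := H.measurable_h
  measurable_k := H.measurable_k
  absCont := by
    simp only [mul_eq_add]
    have hc : AbsolutelyContinuousOnInterval (fun _ : ℝ => g) 0 T :=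
      (LipschitzWith.const g).lipschitzOnWith.absolutelyContinuousOnInterval
    exact hc.fun_add (((ContinuousLinearMap.lipschitz _).lipschitzOnWith
      (s := Set.univ)).comp_absolutelyContinuousOnInterval H.absCont (Set.mapsTo_univ _ _))
  deriv := by
    filter_upwards [H.deriv] with u hu
    simp only [mul_eq_add]
    have h1 := ((ContinuousLinearMap.hasFDerivAt ((ContinuousLinearMap.fst ℝ (Fin n → ℂ) ℝ).prod
      (ContinuousLinearMap.snd ℝ (Fin n → ℂ) ℝ + (2 : ℝ) • (hermImCLM g.1).comp
        (ContinuousLinearMap.fst ℝ (Fin n → ℂ) ℝ)))).comp_hasDerivAt u hu).const_add g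
    refine h1.congr_deriv ?_
    rw [sum_fields (fun j => h j u) (fun j => k j u), sum_fields (fun j => h j u) (fun j => k j u)]
    refine Prod.ext rfl ?_
    simp only [ContinuousLinearMap.prod_apply, _root_.add_apply,
      _root_.smul_apply, ContinuousLinearMap.comp_apply,
      ContinuousLinearMap.coe_fst', ContinuousLinearMap.coe_snd', hermImCLM_apply, herm_im,
      smul_eq_mul, Finset.mul_sum, ← Finset.sum_add_distrib, Prod.fst_add, Pi.add_apply,
      Complex.add_re, Complex.add_im]
    exact Finset.sum_congr rfl fun j _ => by ring

theorem dCC_mul_left_le (g x y : Heisenberg n) : dCC (mul g x) (mul g y) ≤ dCC x y := by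
  refine le_sInf ?_
  rintro _ ⟨T, γ, h, k, H, rfl, rfl, rfl⟩
  exact sInf_le ⟨T, fun u => mul g (γ u), h, k, H.mul_left g, rfl, rfl, rfl⟩

theorem dCC_mul_left (g x y : Heisenberg n) : dCC (mul g x) (mul g y) = dCC x y := by
  refine (dCC_mul_left_le g x y).antisymm ?_
  simpa only [inv_mul_mul] using dCC_mul_left_le (inv g) (mul g x) (mul g y)

theorem mul_mem_interPt {s : ℝ} {x y z : Heisenberg n} (g : Heisenberg n)
    (hz : z ∈ interPt s x y) : mul g z ∈ interPt s (mul g x) (mul g y) := by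
  simpa only [interPt, Set.mem_ofPred_eq, dCC_mul_left] using hz

/-! ### Distance bounds and explicit horizontal curves. -/

theorem le_dCC {x y : Heisenberg n} {ρ : ℝ}
    (hρ : ∀ (T : ℝ) (γ : ℝ → Heisenberg n) (h k : Fin n → ℝ → ℝ), IsHorizontal T γ h k →
      length T h k ≠ ∞ → γ 0 = x → γ T = y → ρ ≤ (length T h k).toReal) :
    ENNReal.ofReal ρ ≤ dCC x y := by
  refine le_sInf ?_
  rintro _ ⟨T, γ, h, k, H, h0, h1, rfl⟩
  by_cases hL : length T h k = ∞
  · simp [hL]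
  · exact ENNReal.ofReal_le_of_le_toReal (hρ T γ h k H hL h0 h1)

/-- The distance between the ends of a smooth horizontal curve of constant speed. -/
theorem dCC_le_of_speed_eq {T c : ℝ} (hT : 0 ≤ T) (hc : 0 ≤ c) {γ : ℝ → Heisenberg n}
    {v : ℝ → Fin n → ℂ} (hγ : ContDiff ℝ 1 γ) (hv : Continuous v)
    (hd : ∀ u, HasDerivAt γ (v u,
      ∑ j, 2 * (((γ u).1 j).im * (v u j).re - ((γ u).1 j).re * (v u j).im)) u)
    (hvc : ∀ u, normSq (v u) = c ^ 2) : dCC (γ 0) (γ T) ≤ ENNReal.ofReal (c * T) := by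
  have hvj : ∀ j, Continuous fun u => v u j := fun j => (continuous_apply j).comp hv
  refine sInf_le_of_le ⟨T, γ, fun j u => (v u j).re, fun j u => (v u j).im, ?_, rfl, rfl, rfl⟩ ?_
  · refine ⟨hT, hγ.contDiffOn.absolutelyContinuousOnInterval,
      fun j => (Complex.continuous_re.comp (hvj j)).measurable,
      fun j => (Complex.continuous_im.comp (hvj j)).measurable,
      Filter.Eventually.of_forall fun u => ?_⟩
    rw [sum_fields (fun j => (v u j).re) (fun j => (v u j).im)]
    exact hd u
  · have : ∀ u, √(∑ j, ((v u j).re ^ 2 + (v u j).im ^ 2)) = c := fun u => by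
      rw [← normSq_eq, hvc, Real.sqrt_sq hc]
    simp [length, this, ENNReal.ofReal_mul hc]

theorem dCC_zero_le (ζ : Fin n → ℂ) :
    dCC ((0, 0) : Heisenberg n) (ζ, 0) ≤ ENNReal.ofReal (√(normSq ζ)) := by
  have h := dCC_le_of_speed_eq (γ := fun u : ℝ => ((u • ζ, 0) : Heisenberg n)) (v := fun _ => ζ)
    zero_le_one (Real.sqrt_nonneg (normSq ζ)) (by fun_prop) continuous_const (fun u => ?_)
    (fun u => (Real.sq_sqrt (normSq_nonneg ζ)).symm)
  · simpa using h
  · have h1 : HasDerivAt (fun u : ℝ => u • ζ) ζ u := by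
      simpa using (hasDerivAt_id u).smul_const ζ
    refine (h1.prodMk (hasDerivAt_const u (0 : ℝ))).congr_deriv ?_
    refine Prod.ext rfl ?_
    change (0 : ℝ) = ∑ j, 2 * (((u • ζ) j).im * (ζ j).re - ((u • ζ) j).re * (ζ j).im)
    refine (Finset.sum_eq_zero fun j _ => ?_).symm
    simp
    ring

theorem geod_of_ne {θ : ℝ} (hθ : θ ≠ 0) (χ : Fin n → ℂ) (u : ℝ) :
    geod χ θ u = ((⟨Real.sin (θ * u) / θ, (Real.cos (θ * u) - 1) / θ⟩ : ℂ) • χ,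
      2 * normSq χ * ((θ * u - Real.sin (θ * u)) / θ ^ 2)) := by
  rw [geod, if_neg hθ]
  congr 2
  have h1 : Complex.exp (-(Complex.I * θ * u)) =
      ⟨Real.cos (θ * u), -Real.sin (θ * u)⟩ := by
    have : -(Complex.I * θ * u) = ((-(θ * u) : ℝ) : ℂ) * Complex.I := by push_cast; ring
    rw [this, Complex.exp_mul_I, ← Complex.ofReal_cos, ← Complex.ofReal_sin,
      Real.cos_neg, Real.sin_neg, ← Complex.mk_eq_add_mul_I]
  rw [h1]
  apply Complex.ext
  · simp [Complex.div_ofReal_im, neg_div]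
  · simp [Complex.div_ofReal_re]

theorem normSq_smul (w : ℂ) (z : Fin n → ℂ) :
    normSq (w • z) = (w.re ^ 2 + w.im ^ 2) * normSq z := by
  rw [normSq_eq, normSq_eq, Finset.mul_sum]
  refine Finset.sum_congr rfl fun j _ => ?_
  simp
  ring

theorem normSq_geod {θ : ℝ} (hθ : θ ≠ 0) (χ : Fin n → ℂ) (u : ℝ) :
    normSq (geod χ θ u).1 = normSq χ * (2 * (1 - Real.cos (θ * u))) / θ ^ 2 := by
  rw [geod_of_ne hθ, normSq_smul]
  field_simp
  linear_combination normSq χ * Real.sin_sq_add_cos_sq (θ * u)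

/-- The horizontal velocity is e^{−iθu}χ, of constant norm |χ|. -/
theorem dCC_geod_le {θ : ℝ} (hθ : θ ≠ 0) (χ : Fin n → ℂ) {a b : ℝ} (hab : a ≤ b) :
    dCC (geod χ θ a) (geod χ θ b) ≤ ENNReal.ofReal (√(normSq χ) * (b - a)) := by
  have hcd : ContDiff ℝ 1 fun u => geod χ θ (a + u) := by
    simp only [geod_of_ne hθ, Complex.mk_eq_add_mul_I]
    have h1 : ContDiff ℝ 1 fun u => ((Real.sin (θ * (a + u)) / θ : ℝ) : ℂ) :=
      Complex.ofRealCLM.contDiff.comp ((Real.contDiff_sin.comp (by fun_prop)).div_const _)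
    have h2 : ContDiff ℝ 1 fun u => (((Real.cos (θ * (a + u)) - 1) / θ : ℝ) : ℂ) :=
      Complex.ofRealCLM.contDiff.comp
        (((Real.contDiff_cos.comp (by fun_prop)).sub contDiff_const).div_const _)
    have h3 : ContDiff ℝ 1 fun u => θ * (a + u) - Real.sin (θ * (a + u)) :=
      ContDiff.sub (by fun_prop) (Real.contDiff_sin.comp (by fun_prop))
    exact ((h1.add (h2.mul contDiff_const)).smul contDiff_const).prodMk
      (contDiff_const.mul (h3.div_const _))
  have h := dCC_le_of_speed_eq (γ := fun u : ℝ => geod χ θ (a + u)) (T := b - a)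
    (v := fun u => (⟨Real.cos (θ * (a + u)), -Real.sin (θ * (a + u))⟩ : ℂ) • χ)
    (sub_nonneg.2 hab) (Real.sqrt_nonneg (normSq χ)) hcd
    (by simp only [Complex.mk_eq_add_mul_I]; fun_prop)
    (fun u => ?_) (fun u => ?_)
  · simpa using h
  · have hφ : HasDerivAt (fun u => θ * (a + u)) θ u := by
      simpa using ((hasDerivAt_id u).const_add a).const_mul θ
    have hs := hφ.sin
    have hc := hφ.cos
    have h1 : ∀ j, HasDerivAt (fun u => (geod χ θ (a + u)).1 j)
        (((⟨Real.cos (θ * (a + u)), -Real.sin (θ * (a + u))⟩ : ℂ) • χ) j) u := fun j => by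
      have hre : ∀ u : ℝ, (geod χ θ (a + u)).1 j = (((Real.sin (θ * (a + u)) / θ : ℝ) : ℂ) +
          (((Real.cos (θ * (a + u)) - 1) / θ : ℝ) : ℂ) * Complex.I) * χ j := fun u => by
        rw [geod_of_ne hθ, ← Complex.mk_eq_add_mul_I]
        rfl
      simp only [hre]
      refine (((hs.div_const θ).ofReal_comp.fun_add
        (((hc.sub_const 1).div_const θ).ofReal_comp.mul_const Complex.I)).mul_const
          (χ j)).congr_deriv ?_
      simp only [Pi.smul_apply, smul_eq_mul]
      rw [mul_div_cancel_right₀ _ hθ, mul_div_cancel_right₀ _ hθ, ← Complex.mk_eq_add_mul_I]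
    have h2 : HasDerivAt (fun u => (geod χ θ (a + u)).2)
        (2 * normSq χ * ((θ - Real.cos (θ * (a + u)) * θ) / θ ^ 2)) u := by
      simp only [geod_of_ne hθ]
      exact ((hφ.sub hs).div_const _).const_mul _
    refine ((hasDerivAt_pi.2 h1).prodMk h2).congr_deriv (Prod.ext rfl ?_)
    simp only [geod_of_ne hθ, normSq_eq, Finset.mul_sum, Finset.sum_mul]
    refine Finset.sum_congr rfl fun j _ => ?_
    simp
    field_simp
    linear_combination (-((χ j).re ^ 2 + (χ j).im ^ 2)) *
      Real.sin_sq_add_cos_sq (θ * (a + u))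
  · rw [normSq_smul, Real.sq_sqrt (normSq_nonneg χ)]
    simp

/-! ### Minimality of the geodesics of angle 2π. -/

theorem geod_zero (χ : Fin n → ℂ) (θ : ℝ) : geod χ θ 0 = (0, 0) := by
  by_cases hθ : θ = 0
  · simp [geod, hθ]
  · simp [geod, hθ]

theorem geod_two_pi_one {χ : Fin n → ℂ} (hχ : normSq χ = Real.pi) :
    geod χ (2 * Real.pi) 1 = (0, 1) := by
  have hπ := Real.pi_pos
  rw [geod_of_ne (by positivity)]
  refine Prod.ext ?_ ?_
  · have : (⟨0, 0⟩ : ℂ) = 0 := rfl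
    simp [this]
  · simp [hχ]
    field_simp

theorem pi_mul_normSq_geod {χ : Fin n → ℂ} (hχ : normSq χ = Real.pi) (s : ℝ) :
    Real.pi * normSq (geod χ (2 * Real.pi) s).1 = Real.sin (Real.pi * s) ^ 2 := by
  have hπ := Real.pi_pos
  rw [normSq_geod (by positivity), hχ, mul_assoc, Real.cos_two_mul]
  field_simp
  linear_combination -2 * Real.sin_sq_add_cos_sq (Real.pi * s)

theorem pi_mul_geod_snd {χ : Fin n → ℂ} (hχ : normSq χ = Real.pi) (s : ℝ) :
    Real.pi * (geod χ (2 * Real.pi) s).2 =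
      Real.pi * s - Real.sin (Real.pi * s) * Real.cos (Real.pi * s) := by
  have hπ := Real.pi_pos
  rw [geod_of_ne (by positivity), hχ, mul_assoc 2 Real.pi s, Real.sin_two_mul]
  field_simp

theorem le_dCC_zero_geod {χ : Fin n → ℂ} (hχ : normSq χ = Real.pi) {s : ℝ} (hs0 : 0 < s)
    (hs1 : s ≤ 1) :
    ENNReal.ofReal (√Real.pi * s) ≤ dCC (0, 0) (geod χ (2 * Real.pi) s) := by
  refine le_dCC fun T γ h k H hL h0 hT => ?_
  have hπ := Real.pi_pos
  have hsπ : 0 < √Real.pi := Real.sqrt_pos.2 hπ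
  have hss : √Real.pi * √Real.pi = Real.pi := Real.mul_self_sqrt hπ.le
  have hL0 : 0 ≤ (length T h k).toReal := ENNReal.toReal_nonneg
  set L := (length T h k).toReal
  by_contra! hlt
  have h1 : √Real.pi * L < Real.pi * s := by
    calc √Real.pi * L < √Real.pi * (√Real.pi * s) := by gcongr
      _ = Real.pi * s := by rw [← mul_assoc, hss]
  have h1' : 0 ≤ √Real.pi * L := by positivity
  have h2 : Real.pi * s ≤ Real.pi := by nlinarith
  -- The phase must start positive, as the cotangent is singular at 0, and end at some β ≤ πs. This
  -- α puts β midway between √π L and πs; the leftover term sin(πs) sin(πs − β)/sin β is then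
  -- nonnegative, and √π L ≥ πs follows.
  have key := H.calibration hL (ε := 1) (α := (Real.pi * s - √Real.pi * L) / 2) (by norm_num)
    (by linarith) (by linarith)
  rw [h0, hT] at key
  have hz : normSq ((0, 0) : Heisenberg n).1 = 0 := by simp [normSq]
  rw [hz, one_mul, pi_mul_geod_snd hχ, mul_right_comm, pi_mul_normSq_geod hχ,
    Real.cot_eq_cos_div_sin] at key
  set β := (Real.pi * s - √Real.pi * L) / 2 + √Real.pi * L with hβ
  have hβ0 : 0 < Real.sin β := Real.sin_pos_of_pos_of_lt_pi (by linarith) (by linarith)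
  have hd : 0 ≤ Real.sin (Real.pi * s - β) :=
    Real.sin_nonneg_of_nonneg_of_le_pi (by linarith) (by linarith)
  have hs : 0 ≤ Real.sin (Real.pi * s) :=
    Real.sin_nonneg_of_nonneg_of_le_pi (by linarith) h2
  rw [Real.sin_sub] at hd
  have h3 : Real.sin (Real.pi * s) ^ 2 * (Real.cos β / Real.sin β) -
      Real.sin (Real.pi * s) * Real.cos (Real.pi * s) =
      Real.sin (Real.pi * s) * (Real.sin (Real.pi * s) * Real.cos β -
        Real.cos (Real.pi * s) * Real.sin β) / Real.sin β := by
    field_simp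
  have h4 : 0 ≤ Real.sin (Real.pi * s) * (Real.sin (Real.pi * s) * Real.cos β -
        Real.cos (Real.pi * s) * Real.sin β) / Real.sin β := by positivity
  simp only [mul_zero, add_zero] at key
  linarith

theorem le_dCC_geod_one {χ : Fin n → ℂ} (hχ : normSq χ = Real.pi) {s : ℝ} (hs0 : 0 < s)
    (hs1 : s < 1) :
    ENNReal.ofReal (√Real.pi * (1 - s)) ≤ dCC (geod χ (2 * Real.pi) s) (0, 1) := by
  refine le_dCC fun T γ h k H hL h0 hT => ?_
  have hπ := Real.pi_pos
  have hsπ : 0 < √Real.pi := Real.sqrt_pos.2 hπ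
  have hss : √Real.pi * √Real.pi = Real.pi := Real.mul_self_sqrt hπ.le
  set L := (length T h k).toReal
  by_contra! hlt
  have h1 : √Real.pi * L < Real.pi * (1 - s) := by
    calc √Real.pi * L < √Real.pi * (√Real.pi * (1 - s)) := by gcongr
      _ = Real.pi * (1 - s) := by rw [← mul_assoc, hss]
  -- The phase of the geodesic itself at time s: the calibrating function then equals πs at the
  -- starting point, and its cotangent term vanishes at (0,1).
  have key := H.calibration hL (ε := 1) (α := Real.pi * s) (by norm_num) (by positivity)
    (by linarith)
  have hz : normSq ((0, 1) : Heisenberg n).1 = 0 := by simp [normSq]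
  have hsin : 0 < Real.sin (Real.pi * s) :=
    Real.sin_pos_of_pos_of_lt_pi (by positivity) (by nlinarith)
  have h2 : Real.sin (Real.pi * s) ^ 2 * (Real.cos (Real.pi * s) / Real.sin (Real.pi * s)) =
      Real.sin (Real.pi * s) * Real.cos (Real.pi * s) := by
    field_simp
  rw [h0, hT, hz, one_mul, pi_mul_geod_snd hχ, mul_right_comm Real.pi (Real.cot (Real.pi * s)),
    pi_mul_normSq_geod hχ, Real.cot_eq_cos_div_sin (Real.pi * s), h2] at key
  simp only [mul_zero, add_zero] at key
  linarith

/-- The geodesics of full angle from `0` to `(0, 1)` consist of intermediate points. -/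
theorem geod_mem_interPt {χ : Fin n → ℂ} (hχ : normSq χ = Real.pi) {s : ℝ}
    (hs : s ∈ Set.Ioo (0 : ℝ) 1) : geod χ (2 * Real.pi) s ∈ interPt s (0, 0) (0, 1) := by
  have hθ : 2 * Real.pi ≠ 0 := by positivity
  have hup : ∀ {a b : ℝ}, a ≤ b → dCC (geod χ (2 * Real.pi) a) (geod χ (2 * Real.pi) b) ≤
      ENNReal.ofReal (√Real.pi * (b - a)) := fun hab => by
    simpa only [hχ] using dCC_geod_le hθ χ hab
  have h01 : dCC ((0, 0) : Heisenberg n) (0, 1) = ENNReal.ofReal √Real.pi := by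
    refine le_antisymm ?_ ?_
    · simpa [geod_zero, geod_two_pi_one hχ] using hup zero_le_one
    · simpa [geod_two_pi_one hχ] using le_dCC_zero_geod hχ zero_lt_one le_rfl
  have h0s := hup hs.1.le
  have hs1 := hup hs.2.le
  rw [geod_zero, sub_zero] at h0s
  rw [geod_two_pi_one hχ] at hs1
  refine ⟨?_, ?_⟩
  · rw [h01, ← ENNReal.ofReal_mul hs.1.le, mul_comm s]
    exact h0s.antisymm (le_dCC_zero_geod hχ hs.1 hs.2.le)
  · rw [h01, ← ENNReal.ofReal_mul (sub_nonneg.2 hs.2.le), mul_comm (1 - s)]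
    exact hs1.antisymm (le_dCC_geod_one hχ hs.1 hs.2)

/-! ### Euclidean size of small balls. -/

/-- Small balls centred on the vertical axis are contained in Euclidean cylinders. -/
theorem bounds_of_mem_ball {t r : ℝ} {y : Heisenberg n} (hr : r ≤ 1 / 2)
    (hy : y ∈ ball ((0, t) : Heisenberg n) r) : normSq y.1 ≤ r ^ 2 ∧ |y.2 - t| ≤ r := by
  obtain ⟨_, ⟨T, γ, h, k, H, h0, hT, rfl⟩, hlt⟩ :=
    sInf_lt_iff.1 (show dCC _ _ < _ from hy)
  have hL : length T h k ≠ ∞ := (hlt.trans_le le_top).ne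
  have hLr : (length T h k).toReal < r := (ENNReal.lt_ofReal_iff_toReal_lt hL).1 hlt
  have hL0 : 0 ≤ (length T h k).toReal := ENNReal.toReal_nonneg
  have h1 := H.normSq_sub_le hL
  have hz : normSq (0 : Fin n → ℂ) = 0 := by simp [normSq]
  rw [h0, hT, sub_zero] at h1
  set L := (length T h k).toReal
  refine ⟨h1.trans (by gcongr), ?_⟩
  have h3 := Real.pi_gt_three
  have hs1 : 1 ≤ √Real.pi := by rw [Real.one_le_sqrt]; linarith
  have hss : √Real.pi * √Real.pi = Real.pi := Real.mul_self_sqrt (by linarith)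
  have hsL : √Real.pi * L < Real.pi / 2 := by nlinarith
  have key : ∀ ε : ℝ, ε ^ 2 = 1 → ε * Real.pi * (y.2 - t) ≤ √Real.pi * L := fun ε hε => by
    -- This phase ends at π/2, where the cotangent vanishes, while |ζ| vanishes at the start; only
    -- heights and length remain. The two signs of ε bound the height on both sides.
    have := H.calibration hL (α := Real.pi / 2 - √Real.pi * L) hε (by linarith) (by linarith)
    rw [h0, hT, hz, sub_add_cancel, Real.cot_eq_cos_div_sin (Real.pi / 2), Real.cos_pi_div_two]
      at this
    simp only [zero_div, mul_zero, zero_mul, add_zero] at this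
    linarith
  have hb : √Real.pi * L ≤ Real.pi * r := by
    have : √Real.pi ≤ Real.pi := by nlinarith
    gcongr
  have hp := key 1 (by norm_num)
  have hm := key (-1) (by norm_num)
  rw [abs_le]
  constructor <;> nlinarith

/-! ### The sphere of intermediate points and its translates. -/

/-- The horizontal part at time s is wχ for a single complex w ≠ 0, and the height depends only on
|χ|. Thus χ can be recovered from any point of the sphere. -/
theorem exists_geod_eq {s R t₀ : ℝ} (hs : s ∈ Set.Ioo (0 : ℝ) 1)
    (hR : Real.pi * R ^ 2 = Real.sin (Real.pi * s) ^ 2)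
    (ht : Real.pi * t₀ = Real.pi * s - Real.sin (Real.pi * s) * Real.cos (Real.pi * s))
    {σ : Fin n → ℂ} (hσ : normSq σ = R ^ 2) :
    ∃ χ : Fin n → ℂ, normSq χ = Real.pi ∧ geod χ (2 * Real.pi) s = (σ, t₀) := by
  have hπ := Real.pi_pos
  have hθ : 2 * Real.pi ≠ 0 := by positivity
  have hsin : 0 < Real.sin (Real.pi * s) :=
    Real.sin_pos_of_pos_of_lt_pi (mul_pos hπ hs.1) (by nlinarith [hs.2])
  set w : ℂ := ⟨Real.sin (2 * Real.pi * s) / (2 * Real.pi),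
    (Real.cos (2 * Real.pi * s) - 1) / (2 * Real.pi)⟩ with hw
  have hwn : w.re ^ 2 + w.im ^ 2 = (Real.sin (Real.pi * s) / Real.pi) ^ 2 := by
    simp only [hw, mul_assoc 2 Real.pi s, Real.cos_two_mul, Real.sin_two_mul]
    field_simp
    linear_combination (4 * Real.cos (Real.pi * s) ^ 2 - 4) *
      Real.sin_sq_add_cos_sq (Real.pi * s)
  have hw0 : w ≠ 0 := fun h0 => by
    rw [h0] at hwn
    have : 0 < (Real.sin (Real.pi * s) / Real.pi) ^ 2 := by positivity
    rw [← hwn] at this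
    simp at this
  have hσχ : w • (w⁻¹ • σ) = σ := smul_inv_smul₀ hw0 σ
  have hχ : normSq (w⁻¹ • σ) = Real.pi := by
    have h1 := normSq_smul w (w⁻¹ • σ)
    rw [hσχ, hσ, hwn] at h1
    have h2 : Real.sin (Real.pi * s) ^ 2 * (normSq (w⁻¹ • σ) - Real.pi) = 0 := by
      generalize normSq (w⁻¹ • σ) = N at h1 ⊢
      rw [div_pow] at h1
      field_simp at h1
      linear_combination Real.pi * hR - h1
    have h3 := (mul_eq_zero.1 h2).resolve_left (by positivity)
    linarith
  refine ⟨w⁻¹ • σ, hχ, ?_⟩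
  have h2 := pi_mul_geod_snd hχ s
  rw [← ht] at h2
  refine Prod.ext ?_ (mul_left_cancel₀ hπ.ne' h2)
  rw [geod_of_ne hθ]
  exact hσχ

/-- Left translates of the sphere of intermediate points of `0` and `(0, 1)` cover a neighbourhood
of it of size comparable to `r`. -/
theorem mem_inter_ball {s R t₀ r c : ℝ} (hs : s ∈ Set.Ioo (0 : ℝ) 1) (hR0 : 0 < R)
    (hR : Real.pi * R ^ 2 = Real.sin (Real.pi * s) ^ 2)
    (ht : Real.pi * t₀ = Real.pi * s - Real.sin (Real.pi * s) * Real.cos (Real.pi * s))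
    (hr : 0 < r) (hr1 : r ≤ 1) (hc : 0 ≤ c) (hcR : c ≤ R ^ 2)
    (hc1 : c ^ 2 * (1 + 1 / (2 * R ^ 2)) < 1) {p : Heisenberg n}
    (hp1 : R ^ 2 ≤ normSq p.1) (hp2 : normSq p.1 < (R + c * r) ^ 2) (hpt : |p.2 - t₀| < c * r) :
    p ∈ inter s (ball ((0, 0) : Heisenberg n) r) (ball ((0, 1) : Heisenberg n) r) := by
  set ν := √(normSq p.1) with hν
  have hνsq : ν ^ 2 = normSq p.1 := Real.sq_sqrt (normSq_nonneg _)
  have hcr : 0 ≤ c * r := by positivity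
  have hνR : R ≤ ν := Real.le_sqrt_of_sq_le hp1
  have hνR' : ν < R + c * r := by
    rw [hν, Real.sqrt_lt' (by positivity)]
    exact hp2
  have hν0 : 0 < ν := hR0.trans_le hνR
  set x := (p.2 - t₀) / (2 * R * ν) with hx
  have hxm : x * (2 * R * ν) = p.2 - t₀ := by rw [hx]; field_simp
  have hx1 : x ^ 2 ≤ 1 := by
    rw [sq_le_one_iff_abs_le_one, hx, abs_div, abs_of_pos (by positivity : 0 < 2 * R * ν),
      div_le_one (by positivity)]
    nlinarith
  set y := √(1 - x ^ 2) with hy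
  have hysq : y ^ 2 = 1 - x ^ 2 := Real.sq_sqrt (by linarith)
  have hy0 : 0 ≤ y := Real.sqrt_nonneg _
  have hyx : 1 - x ^ 2 ≤ y := by nlinarith
  set w : ℂ := ⟨R / ν * y, -(R / ν * x)⟩ with hw
  have hσ : normSq (w • p.1) = R ^ 2 := by
    rw [normSq_smul, ← hνsq]
    simp only [hw]
    field_simp
    linear_combination hysq
  obtain ⟨χ, hχ, hz⟩ := exists_geod_eq hs hR ht hσ
  set ζ := (1 - w) • p.1 with hζ
  have hζn : normSq ζ < r ^ 2 := by
    have h1 : normSq ζ = (ν - R) ^ 2 + 2 * ν * R * (1 - y) := by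
      rw [hζ, normSq_smul, ← hνsq]
      simp only [hw, Complex.sub_re, Complex.sub_im, Complex.one_re, Complex.one_im]
      field_simp
      linear_combination R ^ 2 * hysq
    have h2 : (ν - R) ^ 2 ≤ (c * r) ^ 2 := by
      apply pow_le_pow_left₀ <;> linarith
    have h3 : 2 * ν * R * (1 - y) ≤ (c * r) ^ 2 / (2 * R ^ 2) := by
      calc 2 * ν * R * (1 - y) ≤ 2 * ν * R * x ^ 2 := by gcongr; linarith
        _ = (p.2 - t₀) ^ 2 / (2 * R * ν) := by rw [hx]; field_simp
        _ ≤ (c * r) ^ 2 / (2 * R * ν) := by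
          gcongr 1
          exact sq_le_sq' (by linarith [abs_lt.1 hpt]) (by linarith [abs_lt.1 hpt])
        _ ≤ (c * r) ^ 2 / (2 * R ^ 2) := by
          rw [sq R, ← mul_assoc 2 R R]
          gcongr
    calc normSq ζ ≤ (c * r) ^ 2 + (c * r) ^ 2 / (2 * R ^ 2) := by rw [h1]; gcongr
      _ = r ^ 2 * (c ^ 2 * (1 + 1 / (2 * R ^ 2))) := by ring
      _ < r ^ 2 * 1 := by gcongr
      _ = r ^ 2 := mul_one _
  have hg : dCC ((0, 0) : Heisenberg n) (ζ, 0) < ENNReal.ofReal r := by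
    refine (dCC_zero_le ζ).trans_lt ((ENNReal.ofReal_lt_ofReal_iff hr).2 ?_)
    rwa [Real.sqrt_lt' hr]
  have hmem := mul_mem_interPt ((ζ, 0) : Heisenberg n) (geod_mem_interPt hχ hs)
  have hg0 : mul ((ζ, 0) : Heisenberg n) (0, 0) = (ζ, 0) := by simp [mul, herm]
  -- Centrality of (0,1) makes the translated endpoint also a translate by (0,1) of (ζ,0), hence a
  -- point of the second ball.
  have hg1 : mul ((ζ, 0) : Heisenberg n) (0, 1) = mul ((0, 1) : Heisenberg n) (ζ, 0) := by
    simp [mul, herm]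
  have h10 : mul ((0, 1) : Heisenberg n) (0, 0) = (0, 1) := by simp [mul, herm]
  have hpz : mul ((ζ, 0) : Heisenberg n) (w • p.1, t₀) = p := by
    refine Prod.ext ?_ ?_
    · simp [mul, hζ, sub_smul]
    · have h1 : (herm ζ (w • p.1)).im = R * ν * x := by
        have : R * ν * x = R / ν * x * normSq p.1 := by
          rw [← hνsq]
          field_simp
        rw [this, herm_im, normSq_eq, Finset.mul_sum]
        refine Finset.sum_congr rfl fun j _ => ?_
        simp [hζ, hw]
        ring
      simp only [mul, h1]
      linarith
  rw [hz, hpz, hg0, hg1] at hmem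
  simp only [inter, Set.mem_iUnion]
  refine ⟨(ζ, 0), hg, mul (0, 1) (ζ, 0), ?_, hmem⟩
  change dCC _ _ < _
  have := dCC_mul_left ((0, 1) : Heisenberg n) (0, 0) (ζ, 0)
  rw [h10] at this
  rwa [this]

/-! ### Volume of the annulus and of the intermediate set. -/

theorem continuous_normSq : Continuous (normSq : (Fin n → ℂ) → ℝ) := by
  unfold normSq
  fun_prop

/-- The norm on `Fin n → ℂ` is the sup norm, so Euclidean balls are sublevel sets of `normSq` and
their volumes are found by scaling. -/
theorem volume_normSq_lt {ρ : ℝ} (hρ : 0 < ρ) :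
    volume {z : Fin n → ℂ | normSq z < ρ ^ 2} =
      ENNReal.ofReal (ρ ^ Module.finrank ℝ (Fin n → ℂ)) *
        volume {z : Fin n → ℂ | normSq z < 1} := by
  have : {z : Fin n → ℂ | normSq z < ρ ^ 2} = ρ • {z : Fin n → ℂ | normSq z < 1} := by
    ext z
    rw [Set.mem_smul_set_iff_inv_smul_mem₀ hρ.ne']
    have h1 : normSq (ρ⁻¹ • z) = normSq z / ρ ^ 2 := by
      simp only [normSq, Pi.smul_apply, norm_smul, mul_pow, ← Finset.mul_sum]
      rw [Real.norm_eq_abs, sq_abs]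
      field_simp
    simp only [Set.mem_ofPred_eq, h1]
    rw [div_lt_one (by positivity)]
  rw [this, Measure.addHaar_smul, abs_of_pos (by positivity)]

theorem volume_normSq_lt_one_pos : 0 < volume {z : Fin n → ℂ | normSq z < 1} :=
  (isOpen_lt continuous_normSq continuous_const).measure_pos _ ⟨0, by simp [normSq]⟩

theorem volume_normSq_lt_one_ne_top : volume {z : Fin n → ℂ | normSq z < 1} ≠ ∞ := by
  refine ne_top_of_le_ne_top (measure_ball_lt_top (x := (0 : Fin n → ℂ)) (r := 1)).ne
    (measure_mono fun z hz => ?_)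
  rw [mem_ball_zero_iff, pi_norm_lt_iff one_pos]
  intro j
  have h1 : ‖z j‖ ^ 2 ≤ normSq z :=
    Finset.single_le_sum (f := fun j => ‖z j‖ ^ 2) (fun i _ => sq_nonneg _) (Finset.mem_univ j)
  have h2 : ‖z j‖ ^ 2 < 1 := h1.trans_lt hz
  rwa [sq_lt_one_iff₀ (norm_nonneg _)] at h2

/-- With real dimension m + 1, the bound is (R + ε)^{m+1} − R^{m+1} ≥ R^m ε. -/
theorem exists_le_volume_annulus (hn : 1 ≤ n) {R : ℝ} (hR : 0 < R) :
    ∃ κ > (0 : ℝ), ∀ ε > (0 : ℝ), ENNReal.ofReal (κ * ε) ≤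
      volume {z : Fin n → ℂ | R ^ 2 ≤ normSq z ∧ normSq z < (R + ε) ^ 2} := by
  have : Nonempty (Fin n) := ⟨⟨0, hn⟩⟩
  obtain ⟨m, hm⟩ := Nat.exists_eq_succ_of_ne_zero
    (Module.finrank_pos (R := ℝ) (M := Fin n → ℂ)).ne'
  have hv0 := volume_normSq_lt_one_pos (n := n)
  have hvt := volume_normSq_lt_one_ne_top (n := n)
  set v := volume {z : Fin n → ℂ | normSq z < 1} with hv
  refine ⟨R ^ m * v.toReal, mul_pos (by positivity) (ENNReal.toReal_pos hv0.ne' hvt),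
    fun ε hε => ?_⟩
  have hset : {z : Fin n → ℂ | R ^ 2 ≤ normSq z ∧ normSq z < (R + ε) ^ 2} =
      {z | normSq z < (R + ε) ^ 2} \ {z | normSq z < R ^ 2} := by
    ext z
    simp only [Set.mem_ofPred_eq, Set.mem_sdiff, not_lt, and_comm]
  have hfin : volume {z : Fin n → ℂ | normSq z < R ^ 2} ≠ ∞ := by
    rw [volume_normSq_lt hR]
    exact ENNReal.mul_ne_top ENNReal.ofReal_ne_top hvt
  rw [hset, measure_sdiff (fun z hz => ?_)
    (isOpen_lt continuous_normSq continuous_const).measurableSet.nullMeasurableSet hfin,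
    volume_normSq_lt hR, volume_normSq_lt (by positivity), ← hv, hm, ← ENNReal.sub_mul
      (fun _ _ => hvt), ← ENNReal.ofReal_sub _ (by positivity), mul_right_comm,
    ENNReal.ofReal_mul (by positivity), ENNReal.ofReal_toReal hvt]
  · gcongr
    rw [pow_succ, pow_succ]
    have : R ^ m * (R + ε) ≤ (R + ε) ^ m * (R + ε) := by gcongr; linarith
    linarith
  · have h1 : normSq z < R ^ 2 := hz
    have h2 : R ^ 2 ≤ (R + ε) ^ 2 := by gcongr; linarith
    exact h1.trans_le h2

theorem exists_le_volume_inter (hn : 1 ≤ n) {s : ℝ} (hs : s ∈ Set.Ioo (0 : ℝ) 1) :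
    ∃ c > (0 : ℝ), ∃ δ > (0 : ℝ), ∀ r ∈ Set.Ioo 0 δ, ENNReal.ofReal (c * r ^ 3) ≤
      volume (inter s (ball ((0, 0) : Heisenberg n) r) (ball ((0, 1) : Heisenberg n) r)) := by
  have hπ := Real.pi_pos
  have hsin : 0 < Real.sin (Real.pi * s) :=
    Real.sin_pos_of_pos_of_lt_pi (mul_pos hπ hs.1) (by nlinarith [hs.2])
  obtain ⟨R, hR0, hR⟩ : ∃ R : ℝ, 0 < R ∧ Real.pi * R ^ 2 = Real.sin (Real.pi * s) ^ 2 := by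
    refine ⟨Real.sin (Real.pi * s) / √Real.pi, by positivity, ?_⟩
    rw [div_pow, Real.sq_sqrt hπ.le]
    field_simp
  obtain ⟨t₀, ht⟩ : ∃ t₀ : ℝ, Real.pi * t₀ =
      Real.pi * s - Real.sin (Real.pi * s) * Real.cos (Real.pi * s) :=
    ⟨_, mul_div_cancel₀ _ hπ.ne'⟩
  obtain ⟨c, hc, hcR, hc1⟩ : ∃ c : ℝ, 0 < c ∧ c ≤ R ^ 2 ∧ c ^ 2 * (1 + 1 / (2 * R ^ 2)) < 1 := by
    refine ⟨R ^ 2 / (1 + R ^ 2), by positivity, ?_, ?_⟩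
    · exact div_le_self (by positivity) (by nlinarith)
    · have : (R ^ 2 / (1 + R ^ 2)) ^ 2 * (1 + 1 / (2 * R ^ 2)) =
          R ^ 2 * (2 * R ^ 2 + 1) / (2 * (1 + R ^ 2) ^ 2) := by field_simp
      rw [this, div_lt_one (by positivity)]
      nlinarith [sq_nonneg R]
  obtain ⟨κ, hκ, hvol⟩ := exists_le_volume_annulus hn hR0
  refine ⟨κ * c * (2 * c), by positivity, 1, one_pos, fun r hr => ?_⟩
  have hr0 := hr.1
  calc ENNReal.ofReal (κ * c * (2 * c) * r ^ 3)
      ≤ ENNReal.ofReal (κ * (c * r) * (2 * (c * r))) := by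
        refine ENNReal.ofReal_le_ofReal ?_
        -- The construction yields order r²; since r < 1 this dominates r³.
        have : κ * c * (2 * c) * r ^ 3 ≤ κ * c * (2 * c) * r ^ 2 := by
          gcongr ?_ * ?_
          exact pow_le_pow_of_le_one hr0.le hr.2.le (by norm_num)
        linarith
    _ = ENNReal.ofReal (κ * (c * r)) * ENNReal.ofReal (2 * (c * r)) :=
        ENNReal.ofReal_mul (by positivity)
    _ ≤ volume {z : Fin n → ℂ | R ^ 2 ≤ normSq z ∧ normSq z < (R + c * r) ^ 2} *
        volume (Set.Ioo (t₀ - c * r) (t₀ + c * r)) := by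
        refine mul_le_mul' (hvol _ (by positivity)) (le_of_eq ?_)
        rw [Real.volume_Ioo]
        congr 1
        ring
    _ = volume ({z : Fin n → ℂ | R ^ 2 ≤ normSq z ∧ normSq z < (R + c * r) ^ 2} ×ˢ
        Set.Ioo (t₀ - c * r) (t₀ + c * r)) := by
        rw [Measure.volume_eq_prod, Measure.prod_prod]
    _ ≤ _ := by
        refine measure_mono fun p hp => ?_
        obtain ⟨⟨h1, h2⟩, h3, h4⟩ := hp
        exact mem_inter_ball hs hR0 hR ht hr0 hr.2.le hc.le hcR hc1 h1 h2
          (abs_lt.2 ⟨by linarith, by linarith⟩)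

/-! ### Angles between the two balls. -/

theorem zero_mem_ball {r : ℝ} (hr : 0 < r) : (0, 0) ∈ ball ((0, 0) : Heisenberg n) r := by
  change dCC _ _ < _
  refine (dCC_zero_le 0).trans_lt ?_
  simpa [normSq] using hr

theorem zero_one_mem_ball {r : ℝ} (hr : 0 < r) : (0, 1) ∈ ball ((0, 1) : Heisenberg n) r := by
  change dCC _ _ < _
  have h10 : mul ((0, 1) : Heisenberg n) (0, 0) = (0, 1) := by simp [mul, herm]
  have h1 := dCC_mul_left ((0, 1) : Heisenberg n) (0, 0) (0, 0)
  rw [h10] at h1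
  rw [h1]
  exact zero_mem_ball hr

theorem sub_sin_le_sq {θ : ℝ} (hθ : 0 < θ) : θ - Real.sin θ ≤ θ ^ 2 := by
  rcases le_or_gt θ 1 with h | h
  · have := Real.sin_gt_sub_cube hθ
    nlinarith [pow_pos hθ 2]
  · rcases le_or_gt 2 θ with h2 | h2
    · nlinarith [Real.neg_one_le_sin θ]
    · have := Real.sin_pos_of_pos_of_lt_pi hθ (by linarith [Real.pi_gt_three])
      nlinarith

/-- The bound 1 − cos x ≥ 2x²/π² on [−π, π] is applied to θ when θ ≤ π, contradicting θ − sin θ ≤ θ²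
for small r, and otherwise to 2π − θ. -/
theorem two_pi_sub_le_of_one_sub_cos_le {θ r : ℝ} (hr0 : 0 < r) (hr : r < 1 / 8) (hθ0 : 0 < θ)
    (hθ : θ ≤ 2 * Real.pi) (h : 1 - Real.cos θ ≤ 8 * r ^ 2 * (θ - Real.sin θ)) :
    2 * Real.pi - 20 * r ≤ θ := by
  have hπ := Real.pi_pos
  have hπ3 := Real.pi_gt_three
  have hπ4 := Real.pi_lt_d2
  rcases le_or_gt θ Real.pi with hle | hgt
  · exfalso
    have h1 := Real.cos_le_one_sub_mul_cos_sq (x := θ) (by rwa [abs_of_pos hθ0])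
    have h2 := sub_sin_le_sq hθ0
    have h3 : 2 / Real.pi ^ 2 * θ ^ 2 ≤ 8 * r ^ 2 * θ ^ 2 := by
      have : 8 * r ^ 2 * (θ - Real.sin θ) ≤ 8 * r ^ 2 * θ ^ 2 := by gcongr
      linarith
    have h4 := le_of_mul_le_mul_right h3 (by positivity)
    rw [div_le_iff₀ (by positivity)] at h4
    have h5 : r ^ 2 * Real.pi ^ 2 ≤ (1 / 8) ^ 2 * 3.15 ^ 2 := by gcongr
    norm_num at h5
    linarith
  · have h1 := Real.cos_le_one_sub_mul_cos_sq (x := 2 * Real.pi - θ)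
      (by rw [abs_of_nonneg (by linarith)]; linarith)
    rw [Real.cos_two_pi_sub] at h1
    have h2 : 2 / Real.pi ^ 2 * (2 * Real.pi - θ) ^ 2 ≤ 8 * r ^ 2 * (2 * 3.15 + 1) := by
      have : 8 * r ^ 2 * (θ - Real.sin θ) ≤ 8 * r ^ 2 * (2 * 3.15 + 1) := by
        gcongr
        linarith [Real.neg_one_le_sin θ]
      linarith
    rw [div_mul_eq_mul_div, div_le_iff₀ (by positivity)] at h2
    have h3 : 8 * r ^ 2 * (2 * 3.15 + 1) * Real.pi ^ 2 ≤ 8 * r ^ 2 * (2 * 3.15 + 1) * 3.15 ^ 2 := by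
      gcongr
    have h4 : (2 * Real.pi - θ) ^ 2 ≤ (20 * r) ^ 2 := by nlinarith
    have h5 : |2 * Real.pi - θ| ≤ 20 * r := abs_le_of_sq_le_sq h4 (by positivity)
    linarith [le_abs_self (2 * Real.pi - θ)]

/-- The angles of the geodesics joining points near `0` to points near `(0, 1)` are nearly
`2π`. -/
theorem two_pi_sub_le_of_mem_angles {r a : ℝ} (hr0 : 0 < r) (hr : r < 1 / 8)
    (ha : a ∈ angles (ball ((0, 0) : Heisenberg n) r) (ball ((0, 1) : Heisenberg n) r)) :
    2 * Real.pi - 20 * r ≤ a ∧ a ≤ 2 * Real.pi := by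
  obtain ⟨x, hx, y, hy, χ, θ, hθ, he, rfl⟩ := ha
  have hθ' : |θ| ≤ 2 * Real.pi := abs_le.2 hθ
  refine ⟨?_, hθ'⟩
  obtain ⟨hx1, hx2⟩ := bounds_of_mem_ball (by linarith) hx
  obtain ⟨hy1, hy2⟩ := bounds_of_mem_ball (by linarith) hy
  have hrr : r ^ 2 ≤ r * (1 / 8) := by rw [sq]; gcongr
  have hN : normSq (mul (inv x) y).1 ≤ 4 * r ^ 2 := by
    have : normSq (mul (inv x) y).1 ≤ 2 * normSq x.1 + 2 * normSq y.1 := by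
      simp only [normSq_eq, mul, inv, Finset.mul_sum, ← Finset.sum_add_distrib]
      refine Finset.sum_le_sum fun j _ => ?_
      simp only [Pi.add_apply, Pi.neg_apply, Complex.add_re, Complex.add_im, Complex.neg_re,
        Complex.neg_im]
      nlinarith [sq_nonneg ((x.1 j).re + (y.1 j).re), sq_nonneg ((x.1 j).im + (y.1 j).im)]
    linarith
  have ht : 1 / 2 ≤ (mul (inv x) y).2 := by
    have h1 : -(normSq x.1 + normSq y.1) ≤ 2 * (herm (-x.1) y.1).im := by
      simp only [normSq_eq, herm_im, Finset.mul_sum, ← Finset.sum_add_distrib,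
        ← Finset.sum_neg_distrib]
      refine Finset.sum_le_sum fun j _ => ?_
      simp only [Pi.neg_apply, Complex.neg_re, Complex.neg_im]
      nlinarith [sq_nonneg ((x.1 j).im - (y.1 j).re), sq_nonneg ((x.1 j).re + (y.1 j).im)]
    have h2 := abs_le.1 hx2
    have h3 := abs_le.1 hy2
    simp only [mul, inv]
    linarith [h2.1, h2.2, h3.1, h3.2]
  rw [← he, endpt] at hN ht
  have hθ0 : θ ≠ 0 := fun h0 => by
    simp only [geod, h0, if_true] at ht
    linarith
  rw [normSq_geod hθ0, mul_one] at hN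
  rw [geod_of_ne hθ0] at ht
  simp only [mul_one] at ht
  -- With this A, Γ₁ has squared horizontal norm A(1 − cos θ) and height A(θ − sin θ);
  -- cross-multiplying the two estimates eliminates χ.
  obtain ⟨A, hA⟩ : ∃ A, A = 2 * normSq χ / θ ^ 2 := ⟨_, rfl⟩
  have hA0 : 0 ≤ A := by
    have := normSq_nonneg χ
    rw [hA]
    positivity
  have hN' : A * (1 - Real.cos θ) ≤ 4 * r ^ 2 := by
    rw [hA]
    refine le_of_eq_of_le ?_ hN
    ring
  have ht' : 1 / 2 ≤ A * (θ - Real.sin θ) := by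
    rw [hA]
    refine ht.trans_eq ?_
    ring
  have hpos : 0 < θ - Real.sin θ := by
    by_contra! hle
    linarith [mul_nonpos_of_nonneg_of_nonpos hA0 hle]
  have hθpos : 0 < θ := by
    by_contra! hle
    have := Real.sin_le (x := -θ) (by linarith)
    rw [Real.sin_neg] at this
    linarith
  rw [abs_of_pos hθpos] at hθ' ⊢
  refine two_pi_sub_le_of_one_sub_cos_le hr0 hr hθpos hθ' ?_
  have hc : 0 ≤ 1 - Real.cos θ := by linarith [Real.cos_le_one θ]
  have h1 := mul_le_mul_of_nonneg_right hN' hpos.le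
  have h2 := mul_le_mul_of_nonneg_right ht' hc
  linarith

theorem exists_normSq_eq (hn : 1 ≤ n) {a : ℝ} (ha : 0 ≤ a) : ∃ χ : Fin n → ℂ, normSq χ = a := by
  refine ⟨Pi.single ⟨0, hn⟩ (√a : ℂ), ?_⟩
  rw [normSq, Finset.sum_eq_single ⟨0, hn⟩]
  · simp [Real.sq_sqrt ha]
  · intro j _ hj
    simp [hj]
  · simp

theorem Theta_mem (hn : 1 ≤ n) {r : ℝ} (hr0 : 0 < r) (hr : r < 1 / 8) :
    Theta (ball ((0, 0) : Heisenberg n) r) (ball ((0, 1) : Heisenberg n) r) ∈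
      Set.Icc (2 * Real.pi - 20 * r) (2 * Real.pi) := by
  have hπ := Real.pi_pos
  have hle : ∀ A₀ ⊆ ball ((0, 0) : Heisenberg n) r, ∀ B₀ ⊆ ball ((0, 1) : Heisenberg n) r,
      sInf (angles A₀ B₀) ≤ 2 * Real.pi := fun A₀ hA B₀ hB => by
    rcases (angles A₀ B₀).eq_empty_or_nonempty with h | ⟨a, ha⟩
    · rw [h, Real.sInf_empty]
      positivity
    · have hbdd : BddBelow (angles A₀ B₀) := by
        refine ⟨0, ?_⟩
        rintro _ ⟨x, -, y, -, χ, θ, -, -, rfl⟩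
        exact abs_nonneg θ
      refine csInf_le_of_le hbdd ha ?_
      obtain ⟨x, -, y, -, χ, θ, hθ, -, rfl⟩ := ha
      exact abs_le.2 hθ
  constructor
  -- The full balls already give the lower bound. The angle 2π joining the centres shows that their
  -- set of angles is nonempty.
  · have h1 : 2 * Real.pi - 20 * r ≤
        sInf (angles (ball ((0, 0) : Heisenberg n) r) (ball ((0, 1) : Heisenberg n) r)) := by
      obtain ⟨χ, hχ⟩ := exists_normSq_eq hn hπ.le
      refine le_csInf ⟨|2 * Real.pi|, (0, 0), zero_mem_ball hr0, (0, 1), zero_one_mem_ball hr0, χ,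
        2 * Real.pi, ⟨by linarith, le_rfl⟩, ?_, rfl⟩
        fun a ha => (two_pi_sub_le_of_mem_angles hr0 hr ha).1
      rw [endpt, geod_two_pi_one hχ]
      simp [mul, inv, herm]
    refine le_csSup_of_le ⟨2 * Real.pi, ?_⟩ ⟨_, _, subset_rfl, subset_rfl, ⟨_, zero_mem_ball hr0⟩,
      ⟨_, zero_one_mem_ball hr0⟩, by simp, by simp, rfl⟩ h1
    rintro _ ⟨A₀, B₀, hA, hB, -, -, -, -, rfl⟩
    exact hle A₀ hA B₀ hB
  · refine Real.sSup_le ?_ (by positivity)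
    rintro _ ⟨A₀, B₀, hA, hB, -, -, -, -, rfl⟩
    exact hle A₀ hA B₀ hB

/-! ### Blow-up of the distortion coefficient. -/

theorem sin_sub_mul_cos_pos {x : ℝ} (hx : x ∈ Set.Ioo 0 Real.pi) :
    0 < Real.sin x - x * Real.cos x := by
  rcases lt_or_ge x (Real.pi / 2) with h | h
  · have hc : 0 < Real.cos x := Real.cos_pos_of_mem_Ioo ⟨by linarith [hx.1, Real.pi_pos], h⟩
    have h1 := Real.lt_tan hx.1 h
    rw [Real.tan_eq_sin_div_cos, lt_div_iff₀ hc] at h1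
    linarith
  · have hc : Real.cos x ≤ 0 := Real.cos_nonpos_of_pi_div_two_le_of_le h (by linarith [hx.2, hx.1])
    have hs := Real.sin_pos_of_pos_of_lt_pi hx.1 hx.2
    nlinarith [hx.1]

/-- For θ in [π, 2π] the numerators have arguments in a compact subset of (0, π), so they are
bounded below by some m, m' > 0. The denominators are at most 10r and 5. -/
theorem exists_le_tau (hn : 1 ≤ n) {s : ℝ} (hs : s ∈ Set.Ioo (0 : ℝ) 1) :
    ∃ c > (0 : ℝ), ∀ r > (0 : ℝ), ∀ θ ∈ Set.Icc (2 * Real.pi - 20 * r) (2 * Real.pi),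
      Real.pi ≤ θ → ENNReal.ofReal (c * r ^ ((1 - 2 * n : ℝ) / (1 + 2 * n))) ≤ tau n s θ := by
  have hπ := Real.pi_pos
  have hs0 := hs.1
  have hsub : ∀ x ∈ Set.Icc (Real.pi * s / 2) (Real.pi * s), x ∈ Set.Ioo 0 Real.pi :=
    fun x hx => ⟨lt_of_lt_of_le (by positivity) hx.1, lt_of_le_of_lt hx.2 (by nlinarith [hs.2])⟩
  obtain ⟨m, hm, hsin⟩ := isCompact_Icc.exists_forall_le' (Real.continuous_sin.continuousOn)
    (a := 0) (fun x hx => Real.sin_pos_of_mem_Ioo (hsub x hx))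
  obtain ⟨m', hm', hsin'⟩ := isCompact_Icc.exists_forall_le'
    (f := fun x => Real.sin x - x * Real.cos x) (by fun_prop)
    (a := 0) (fun x hx => sin_sub_mul_cos_pos (hsub x hx))
  have hn' : (1 : ℝ) ≤ n := by exact_mod_cast hn
  set p : ℝ := (2 * n - 1 : ℝ) / (2 * n + 1) with hp
  have hp0 : 0 ≤ p := by
    rw [hp]
    exact div_nonneg (by linarith) (by linarith)
  set q : ℝ := (1 : ℝ) / (2 * n + 1) with hq
  have hq0 : 0 ≤ q := by positivity
  refine ⟨s ^ q * (m / 10) ^ p * (m' / 5) ^ q, by positivity, fun r hr θ hθ hθπ => ?_⟩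
  rcases hθ.2.eq_or_lt with h2 | h2
  · simp [tau, h2]
  rw [tau, if_neg h2.ne, if_neg (by linarith)]
  refine ENNReal.ofReal_le_ofReal ?_
  have hmem : θ * s / 2 ∈ Set.Icc (Real.pi * s / 2) (Real.pi * s) := by
    constructor <;> nlinarith
  have hθ2 : θ / 2 ∈ Set.Ioo 0 Real.pi := ⟨by linarith, by linarith⟩
  have hden : 0 < Real.sin (θ / 2) := Real.sin_pos_of_mem_Ioo hθ2
  have hden' : Real.sin (θ / 2) ≤ 10 * r := by
    -- Reflection turns closeness of θ to 2π into smallness: sin(π − θ/2) ≤ π − θ/2 ≤ 10r.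
    have h3 : Real.sin (θ / 2) = Real.sin (Real.pi - θ / 2) := (Real.sin_pi_sub _).symm
    rw [h3]
    exact (Real.sin_le (by linarith)).trans (by linarith [hθ.1])
  have hden2 := sin_sub_mul_cos_pos hθ2
  have hden2' : Real.sin (θ / 2) - θ / 2 * Real.cos (θ / 2) ≤ 5 := by
    nlinarith [Real.sin_le_one (θ / 2), Real.neg_one_le_cos (θ / 2), Real.pi_lt_d2]
  have hr' : r ^ ((1 - 2 * n : ℝ) / (1 + 2 * n)) = (r ^ p)⁻¹ := by
    rw [← Real.rpow_neg hr.le, hp, ← neg_div, neg_sub, add_comm (1 : ℝ)]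
  have h5 : (m / 10) ^ p * (r ^ p)⁻¹ = (m / (10 * r)) ^ p := by
    rw [← div_eq_mul_inv, ← Real.div_rpow (by positivity) hr.le, div_div]
  rw [hr', mul_right_comm, mul_assoc (s ^ q), h5]
  have hs1 := hsin _ hmem
  have hs2 := hsin' _ hmem
  have hs1' := hm.le.trans hs1
  have hs2' := hm'.le.trans hs2
  gcongr

end Heisenberg

end

theorem proposition4p2 (n : ℕ) (hn : 1 ≤ n) (s : ℝ) (hs : s ∈ Set.Ioo (0 : ℝ) 1) :
    (∃ c > (0 : ℝ), ∃ δ > (0 : ℝ), ∀ r ∈ Set.Ioo 0 δ,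
      ENNReal.ofReal (c * r ^ 3) ≤ MeasureTheory.volume
        (Heisenberg.inter s (Heisenberg.ball ((0, 0) : Heisenberg n) r)
          (Heisenberg.ball ((0, 1) : Heisenberg n) r))) ∧
    (∃ C > (0 : ℝ), ∃ δ > (0 : ℝ), ∀ r ∈ Set.Ioo 0 δ,
      |2 * Real.pi - Heisenberg.Theta (Heisenberg.ball ((0, 0) : Heisenberg n) r)
        (Heisenberg.ball ((0, 1) : Heisenberg n) r)| ≤ C * r) ∧
    (∃ c > (0 : ℝ), ∃ δ > (0 : ℝ), ∀ r ∈ Set.Ioo 0 δ,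
      ENNReal.ofReal (c * r ^ ((1 - 2 * n : ℝ) / (1 + 2 * n))) ≤
        Heisenberg.tau n s (Heisenberg.Theta (Heisenberg.ball ((0, 0) : Heisenberg n) r)
          (Heisenberg.ball ((0, 1) : Heisenberg n) r))) := by
  refine ⟨Heisenberg.exists_le_volume_inter hn hs, ⟨20, by norm_num, 1 / 8, by norm_num,
    fun r hr => ?_⟩, ?_⟩
  · have h := Heisenberg.Theta_mem hn hr.1 hr.2
    rw [abs_of_nonneg (by linarith [h.2])]
    linarith [h.1]
  · obtain ⟨c, hc, H⟩ := Heisenberg.exists_le_tau hn hs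
    refine ⟨c, hc, 1 / 8, by norm_num, fun r hr => ?_⟩
    have h := Heisenberg.Theta_mem hn hr.1 hr.2
    exact H r hr.1 _ h (by linarith [h.1, hr.2, Real.pi_gt_three])
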